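/- Let $\mathcal H$ be a complex Hilbert space and let $\mathcal C\subset\mathcal H$ be a dense subset. An operator $A:\mathcal D(A)\to\mathcal H$ is called accretive if $\operatorname{Re}\langle f,Af\rangle\ge 0$ for all $f\in\mathcal D(A)$; it is $m$-accretive if moreover, for all $\lambda>0$, the inverse $(A+\lambda)^{-1}$ exists as a bounded operator on $\mathcal H$ and satisfies $\|(A+\lambda)^{-1}\|\le\lambda^{-1}$; it is quasi $m$-accretive if $A+\lambda$ is $m$-accretive for some $\lambda\in\mathbb R$, and quasi $m$-dissipative if $-A$ is quasi $m$-accretive. An operator has compact resolvent if its resolvent set is non-empty and its resolvent is a compact operator at every point of the resolvent set. Let $K:\mathcal D(K)\to\mathcal H$ be a quasi $m$-accretive (or quasi $m$-dissipative) operator, and let $\Lambda^2:\mathcal D(\Lambda^2)\to\mathcal H$ be a positive (i.e. $\langle f,\Lambda^2 f\rangle\ge 0$ on $\mathcal D(\Lambda^2)$) self-adjoint operator with compact resolvent such that $\mathcal C\subset\mathcal D(\Lambda^2)$. Assume that $\mathcal C$ is a core for $K$, that is, $\mathcal C\subset\mathcal D(K)$ and the graph of $K$ is the closure of $\{(f,Kf):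 f\in\mathcal C\}$. Write $\Lambda^\varepsilon=(\Lambda^2)^{\varepsilon/2}$, defined by functional calculus. If there are constants $C>0$ and $0<\varepsilon<2$ such that $$\|\Lambda^\varepsilon f\|\le C\bigl(\|Kf\|+\|f\|\bigr)\qquad\text{for all } f\in\mathcal C,$$ then $K$ has compact resolvent. -/

import Mathlib

open scoped InnerProductSpace

namespace UnboundedOp

variable {H : Type*} [NormedAddCommGroup H] [InnerProductSpace ℂ H]

/-- The operator `A + z` with domain `D(A)`. -/
def addScalar (A : H →ₗ.[ℂ] H) (z : ℂ) : H →ₗ.[ℂ] H :=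
  (z • (LinearMap.id : H →ₗ[ℂ] H)) +ᵥ A

theorem addScalar_apply (A : H →ₗ.[ℂ] H) (z : ℂ) (u : A.domain) :
    addScalar A z u = z • (u : H) + A u := rfl

/-- `S` is the (everywhere defined, bounded) inverse of `A : D(A) → H`:
it maps `H` into `D(A)`, with `A S = 1` on `H` and `S A = 1` on `D(A)`. -/
def IsBoundedInverse (A : H →ₗ.[ℂ] H) (S : H →L[ℂ] H) : Prop :=
  (∀ f : H, ∃ hf : S f ∈ A.domain, A ⟨S f, hf⟩ = f) ∧ ∀ u : A.domain, S (A u) = u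

/-- The resolvent set of `A`: all `z` such that `A - z` has a bounded inverse. -/
def resolventSet (A : H →ₗ.[ℂ] H) : Set ℂ :=
  {z | ∃ S : H →L[ℂ] H, IsBoundedInverse (addScalar A (-z)) S}

/-- `A` has compact resolvent: its resolvent set is non-empty, and `(A - z)⁻¹` is a compact
operator for every `z` in the resolvent set. -/
def HasCompactResolvent (A : H →ₗ.[ℂ] H) : Prop :=
  (resolventSet A).Nonempty ∧
    ∀ (z : ℂ) (S : H →L[ℂ] H), IsBoundedInverse (addScalar A (-z)) S → IsCompactOperator S

/-- `A` is accretive: `Re ⟨f, A f⟩ ≥ 0` on `D(A)`. -/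
def IsAccretive (A : H →ₗ.[ℂ] H) : Prop :=
  ∀ f : A.domain, 0 ≤ (⟪(f : H), A f⟫_ℂ).re

/-- `A` is m-accretive: it is accretive and, for all `r > 0`, the inverse `(A + r)⁻¹` exists and
has norm at most `r⁻¹`. -/
def IsMAccretive (A : H →ₗ.[ℂ] H) : Prop :=
  IsAccretive A ∧ ∀ r : ℝ, 0 < r →
    ∃ S : H →L[ℂ] H, IsBoundedInverse (addScalar A (r : ℂ)) S ∧ ‖S‖ ≤ r⁻¹

/-- `A` is quasi m-accretive: `A + r` is m-accretive for some real `r`. -/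
def IsQuasiMAccretive (A : H →ₗ.[ℂ] H) : Prop :=
  ∃ r : ℝ, IsMAccretive (addScalar A (r : ℂ))

/-- `A` is quasi m-dissipative: `-A` is quasi m-accretive. -/
def IsQuasiMDissipative (A : H →ₗ.[ℂ] H) : Prop :=
  IsQuasiMAccretive (-A)

/-- `C` is a core for `A`: `C ⊆ D(A)` and the closure of (the graph of) `A` restricted to `C` is
(the graph of) `A`. In particular `A` is closed and `C` is dense in `D(A)` for the graph norm. -/
structure IsCore (A : H →ₗ.[ℂ] H) (C : Set H) : Prop where
  subset_domain : C ⊆ (A.domain : Set H)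
  closure_eq : closure {p : H × H | p ∈ A.graph ∧ p.1 ∈ C} = (A.graph : Set (H × H))

/-- For closed operators and linear subspaces, `IsCore` is Mathlib's `LinearPMap.HasCore`. -/
theorem isCore_iff_hasCore {A : H →ₗ.[ℂ] H} (hA : A.IsClosed) (C : Submodule ℂ H) :
    IsCore A (C : Set H) ↔ A.HasCore C := by
  have hset : {p : H × H | p ∈ A.graph ∧ p.1 ∈ (C : Set H)}
      = ((A.domRestrict C).graph : Set (H × H)) := by
    ext ⟨x, y⟩
    simp only [Set.mem_ofPred_eq, SetLike.mem_coe, LinearPMap.mem_graph_iff]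
    constructor
    · rintro ⟨⟨u, hu, rfl⟩, hx⟩
      subst hu
      exact ⟨⟨u, ⟨hx, u.2⟩⟩, rfl, LinearPMap.domRestrict_apply rfl⟩
    · rintro ⟨⟨u, hu⟩, rfl, rfl⟩
      exact ⟨⟨⟨u, hu.2⟩, rfl, (LinearPMap.domRestrict_apply rfl).symm⟩, hu.1⟩
  have hcl : (A.domRestrict C).IsClosable :=
    hA.isClosable.leIsClosable LinearPMap.domRestrict_le
  have hg := hcl.graph_closure_eq_closure_graph
  constructor
  · rintro ⟨h1, h2⟩
    refine ⟨h1, LinearPMap.eq_of_eq_graph ?_⟩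
    rw [← hg]
    apply SetLike.coe_injective
    rw [Submodule.topologicalClosure_coe, ← hset, h2]
  · rintro ⟨h1, h2⟩
    refine ⟨h1, ?_⟩
    rw [hset, ← Submodule.topologicalClosure_coe, hg, h2]

/-- `T` is positive: `Re ⟨f, T f⟩ ≥ 0` on `D(T)` (for symmetric `T`, the product is real). -/
def IsPositiveOp (T : H →ₗ.[ℂ] H) : Prop :=
  ∀ f : T.domain, 0 ≤ (⟪(f : H), T f⟫_ℂ).re

open Classical in
/-- The bounded inverse of `A`, if there is one (junk value `0` otherwise). -/
noncomputable def boundedInverse (A : H →ₗ.[ℂ] H) : H →L[ℂ] H :=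
  if h : ∃ S : H →L[ℂ] H, IsBoundedInverse A S then h.choose else 0

theorem boundedInverse_spec {A : H →ₗ.[ℂ] H} (h : ∃ S : H →L[ℂ] H, IsBoundedInverse A S) :
    IsBoundedInverse A (boundedInverse A) := by
  rw [boundedInverse, dif_pos h]
  exact h.choose_spec

variable [CompleteSpace H]

/-- The pairs `(f, g)` with `R ^ s g = (1 - R) ^ s f`, where `R = (T + 1)⁻¹` and the powers of the
bounded self-adjoint operators `R` and `1 - R` are taken in the functional calculus. -/
noncomputable def powGraph (T : H →ₗ.[ℂ] H) (s : ℝ) : Submodule ℂ (H × H) :=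
  let R : H →L[ℂ] H := boundedInverse (addScalar T 1)
  LinearMap.ker
    (((cfc (fun x : ℝ => x ^ s) R : H →L[ℂ] H) : H →ₗ[ℂ] H) ∘ₗ LinearMap.snd ℂ H H
      - ((cfc (fun x : ℝ => (1 - x) ^ s) R : H →L[ℂ] H) : H →ₗ[ℂ] H) ∘ₗ LinearMap.fst ℂ H H)

/-- The power `T ^ s`, `s > 0`, of a positive self-adjoint operator `T`, by functional calculus.
In a spectral representation in which `T` is multiplication by `t ≥ 0`, the operator
`R = (T + 1)⁻¹` is multiplication by `(1 + t)⁻¹` and `1 - R` is multiplication by `t (1 + t)⁻¹`.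
So `R ^ s g = (1 - R) ^ s f` reads `(1 + t) ^ (-s) * g = t ^ s * (1 + t) ^ (-s) * f`,
that is `g = t ^ s * f`, and the domain consists of all `f` such that `t ^ s * f` lies in `H`. -/
noncomputable def rpow (T : H →ₗ.[ℂ] H) (s : ℝ) : H →ₗ.[ℂ] H :=
  (powGraph T s).toLinearPMap

theorem mem_powGraph {T : H →ₗ.[ℂ] H} {s : ℝ} {f g : H} : (f, g) ∈ powGraph T s ↔
    (cfc (fun x : ℝ => x ^ s) (boundedInverse (addScalar T 1)) : H →L[ℂ] H) g
      = (cfc (fun x : ℝ => (1 - x) ^ s) (boundedInverse (addScalar T 1)) : H →L[ℂ] H) f := by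
  simp [powGraph, sub_eq_zero]

/-- `T + 1` is boundedly invertible if `T` is positive and self-adjoint. -/
theorem exists_isBoundedInverse {T : H →ₗ.[ℂ] H} (hT : IsSelfAdjoint T) (hp : IsPositiveOp T) :
    ∃ S : H →L[ℂ] H, IsBoundedInverse (addScalar T 1) S := by
  have hd := hT.dense_domain
  let B : T.domain →ₗ[ℂ] H := (addScalar T 1).toFun
  have hB : ∀ u : T.domain, B u = (u : H) + T u := fun u => by
    change addScalar T 1 u = _
    rw [addScalar_apply, one_smul]
  have hlow : ∀ u : T.domain, ‖(u : H)‖ ≤ ‖B u‖ := by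
    intro u
    have h1 : ‖(u : H)‖ * ‖(u : H)‖ ≤ (⟪(u : H), B u⟫_ℂ).re := by
      rw [hB, inner_add_right, Complex.add_re]
      have := hp u
      have h2 : (⟪(u : H), (u : H)⟫_ℂ).re = ‖(u : H)‖ * ‖(u : H)‖ :=
        inner_self_eq_norm_mul_norm (𝕜 := ℂ) (u : H)
      linarith
    have h3 : (⟪(u : H), B u⟫_ℂ).re ≤ ‖(u : H)‖ * ‖B u‖ := re_inner_le_norm (𝕜 := ℂ) _ _
    rcases (norm_nonneg (u : H)).eq_or_lt with h | h
    · rw [← h]; positivity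
    · exact le_of_mul_le_mul_left (h1.trans h3) h
  have hclosed : IsClosed (LinearMap.range B : Set H) := by
    rw [← isSeqClosed_iff_isClosed]
    intro y y₀ hy hlim
    choose u hu using hy
    have hcau : CauchySeq (fun n => (u n : H)) := by
      rw [Metric.cauchySeq_iff']
      intro ε hε
      obtain ⟨N, hN⟩ := Metric.cauchySeq_iff'.1 hlim.cauchySeq ε hε
      refine ⟨N, fun n hn => lt_of_le_of_lt ?_ (hN n hn)⟩
      rw [dist_eq_norm, dist_eq_norm, ← hu, ← hu, ← map_sub]
      exact hlow (u n - u N)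
    obtain ⟨x, hx⟩ := cauchySeq_tendsto_of_complete hcau
    have hTu : Filter.Tendsto (fun n => T (u n)) Filter.atTop (nhds (y₀ - x)) := by
      have : (fun n => T (u n)) = fun n => y n - (u n : H) := by
        funext n; rw [← hu, hB]; simp
      rw [this]
      exact hlim.sub hx
    have hmem : (x, y₀ - x) ∈ T.graph :=
      hT.isClosed.mem_of_tendsto (hx.prodMk_nhds hTu)
        (Filter.Eventually.of_forall fun n => T.mem_graph (u n))
    obtain ⟨v, hv1, hv2⟩ := (LinearPMap.mem_graph_iff T).1 hmem
    refine ⟨v, ?_⟩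
    simp only at hv1 hv2
    rw [hB, hv2, hv1]; simp
  have hsurj : LinearMap.range B = ⊤ := by
    have : CompleteSpace (LinearMap.range B) := hclosed.completeSpace_coe
    rw [← Submodule.orthogonal_eq_bot_iff, Submodule.eq_bot_iff]
    intro v hv
    have hv' : ∀ u : T.domain, ⟪-v, (u : H)⟫_ℂ = ⟪v, T u⟫_ℂ := by
      intro u
      have := (Submodule.mem_orthogonal' _ _).1 hv (B u) ⟨u, rfl⟩
      rw [hB, inner_add_right] at this
      rw [inner_neg_left]
      linear_combination -this
    have hmem : v ∈ (LinearPMap.adjoint T).domain :=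
      LinearPMap.mem_adjoint_domain_of_exists v ⟨-v, hv'⟩
    have hval := LinearPMap.adjoint_apply_eq hd ⟨v, hmem⟩ hv'
    have hg : (v, -v) ∈ (LinearPMap.adjoint T).graph := by
      rw [← hval]; exact LinearPMap.mem_graph _ ⟨v, hmem⟩
    rw [LinearPMap.isSelfAdjoint_def.1 hT] at hg
    obtain ⟨w, hw1, hw2⟩ := (LinearPMap.mem_graph_iff T).1 hg
    simp only at hw1 hw2
    have := hlow w
    rw [hB, hw2, hw1] at this
    simpa using this
  have hinj : Function.Injective B := by
    rw [injective_iff_map_eq_zero]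
    intro u hu
    have := hlow u
    rw [hu, norm_zero] at this
    exact Subtype.ext (norm_le_zero_iff.1 this)
  let e : T.domain ≃ₗ[ℂ] H := LinearEquiv.ofBijective B ⟨hinj, LinearMap.range_eq_top.1 hsurj⟩
  have he : ∀ u, e u = B u := fun _ => rfl
  refine ⟨(T.domain.subtype ∘ₗ e.symm.toLinearMap).mkContinuous 1 fun f => ?_, fun f => ?_,
    fun u => ?_⟩
  · have := hlow (e.symm f)
    rw [← he, e.apply_symm_apply] at this
    simpa using this
  · exact ⟨(e.symm f).2, e.apply_symm_apply f⟩
  · exact congrArg Subtype.val (e.symm_apply_apply u)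

theorem boundedInverse_nonneg {T : H →ₗ.[ℂ] H} (hT : IsSelfAdjoint T) (hp : IsPositiveOp T) :
    0 ≤ boundedInverse (addScalar T 1) := by
  obtain ⟨h1, -⟩ := boundedInverse_spec (exists_isBoundedInverse hT hp)
  set R := boundedInverse (addScalar T 1)
  have hsym : ∀ u v : T.domain, ⟪T u, (v : H)⟫_ℂ = ⟪(u : H), T v⟫_ℂ := by
    have := LinearPMap.adjoint_isFormalAdjoint (T := T) hT.dense_domain
    rw [LinearPMap.isSelfAdjoint_def.1 hT] at this
    exact this
  rw [ContinuousLinearMap.nonneg_iff_isPositive]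
  refine ⟨fun f g => ?_, fun f => ?_⟩
  · obtain ⟨hf, ef⟩ := h1 f
    obtain ⟨hg, eg⟩ := h1 g
    have := hsym ⟨R f, hf⟩ ⟨R g, hg⟩
    replace ef : (1 : ℂ) • R f + T ⟨R f, hf⟩ = f := ef
    replace eg : (1 : ℂ) • R g + T ⟨R g, hg⟩ = g := eg
    rw [one_smul] at ef eg
    have e1 : ⟪R f, g⟫_ℂ = ⟪R f, R g + T ⟨R g, hg⟩⟫_ℂ := congrArg (fun x => ⟪R f, x⟫_ℂ) eg.symm
    have e2 : ⟪R f + T ⟨R f, hf⟩, R g⟫_ℂ = ⟪f, R g⟫_ℂ := congrArg (fun x => ⟪x, R g⟫_ℂ) ef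
    exact e1.trans (((inner_add_right _ _ _).trans (congrArg _ this.symm)).trans
      ((inner_add_left _ _ _).symm.trans e2))
  · obtain ⟨hf, ef⟩ := h1 f
    have := hp ⟨R f, hf⟩
    replace ef : (1 : ℂ) • R f + T ⟨R f, hf⟩ = f := ef
    rw [one_smul] at ef
    change 0 ≤ (⟪R f, f⟫_ℂ).re
    nth_rewrite 2 [← ef]
    rw [inner_add_right, Complex.add_re]
    exact add_nonneg (inner_self_nonneg (𝕜 := ℂ) (x := R f)) this

/-- `powGraph T s` is the graph of an operator, so that `rpow T s` is the operator whose graph is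
`powGraph T s`. -/
theorem graph_rpow {T : H →ₗ.[ℂ] H} (hT : IsSelfAdjoint T) (hp : IsPositiveOp T)
    {s : ℝ} (hs : 0 < s) : (rpow T s).graph = powGraph T s := by
  refine Submodule.toLinearPMap_graph_eq _ ?_
  rintro ⟨f, g⟩ hfg rfl
  obtain ⟨h1, -⟩ := boundedInverse_spec (exists_isBoundedInverse hT hp)
  have hR := boundedInverse_nonneg hT hp
  rw [mem_powGraph, map_zero] at hfg
  set R := boundedInverse (addScalar T 1)
  have hsa : IsSelfAdjoint R := IsSelfAdjoint.of_nonneg hR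
  have hinj : ∀ x, R x = 0 → x = 0 := by
    intro x hx
    obtain ⟨hf, ef⟩ := h1 x
    have h0 : (⟨R x, hf⟩ : (addScalar T 1).domain) = 0 := Subtype.ext hx
    rw [← ef, h0, LinearPMap.map_zero]
  obtain ⟨n, hn⟩ := exists_nat_ge s
  have hmul : (cfc (fun x : ℝ => x ^ ((n : ℝ) - s)) R : H →L[ℂ] H) * cfc (fun x : ℝ => x ^ s) R
      = R ^ n := by
    rw [← cfc_mul _ _ R (Real.continuous_rpow_const (by linarith)).continuousOn
      (Real.continuous_rpow_const hs.le).continuousOn, ← cfc_pow_id (R := ℝ) R n hsa]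
    refine cfc_congr fun x hx => ?_
    have hx0 : 0 ≤ x := spectrum_nonneg_of_nonneg hR hx
    have hne : (n : ℝ) - s + s ≠ 0 := by linarith
    rw [← Real.rpow_add' hx0 hne, sub_add_cancel, Real.rpow_natCast]
  have hpow : ∀ k : ℕ, (R ^ k) g = 0 → g = 0 := by
    intro k
    induction k with
    | zero => intro h; simpa using h
    | succ k ih =>
      intro h
      rw [pow_succ'] at h
      exact ih (hinj _ h)
  refine hpow n ?_
  rw [← hmul, mul_apply_eq_comp, hfg, map_zero]

/-- `D(T) ⊆ D(T ^ s)` for `0 < s ≤ 1`. -/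
theorem domain_le_domain_rpow {T : H →ₗ.[ℂ] H} (hT : IsSelfAdjoint T) (hp : IsPositiveOp T)
    {s : ℝ} (hs : 0 < s) (hs1 : s ≤ 1) : T.domain ≤ (rpow T s).domain := by
  intro f hf
  rw [LinearPMap.mem_domain_iff]
  obtain ⟨-, h2⟩ := boundedInverse_spec (exists_isBoundedInverse hT hp)
  have hR := boundedInverse_nonneg hT hp
  simp only [graph_rpow hT hp hs, mem_powGraph]
  set R := boundedInverse (addScalar T 1)
  have hsa : IsSelfAdjoint R := IsSelfAdjoint.of_nonneg hR
  have hmul : (cfc (fun x : ℝ => x ^ s) R : H →L[ℂ] H) * cfc (fun x : ℝ => x ^ (1 - s)) R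
      = R := by
    rw [← cfc_mul _ _ R (Real.continuous_rpow_const hs.le).continuousOn
      (Real.continuous_rpow_const (by linarith)).continuousOn]
    nth_rewrite 2 [← cfc_id (R := ℝ) R hsa]
    refine cfc_congr fun x hx => ?_
    have hx0 : 0 ≤ x := spectrum_nonneg_of_nonneg hR hx
    have hne : s + (1 - s) ≠ 0 := by simp
    rw [← Real.rpow_add' hx0 hne]
    simp
  have hcomm : Commute (cfc (fun x : ℝ => (1 - x) ^ s) R : H →L[ℂ] H) R := by
    have := cfc_commute_cfc (fun x : ℝ => (1 - x) ^ s) id R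
    rwa [cfc_id (R := ℝ) R hsa] at this
  refine ⟨(cfc (fun x : ℝ => x ^ (1 - s)) R : H →L[ℂ] H)
    ((cfc (fun x : ℝ => (1 - x) ^ s) R : H →L[ℂ] H) (addScalar T 1 ⟨f, hf⟩)), ?_⟩
  have h3 : R (addScalar T 1 ⟨f, hf⟩) = f := h2 ⟨f, hf⟩
  rw [← mul_apply_eq_comp, hmul, ← mul_apply_eq_comp, ← hcomm.eq,
    mul_apply_eq_comp, h3]

/-- Consistency check: `T ^ 1 = T`. -/
theorem rpow_one {T : H →ₗ.[ℂ] H} (hT : IsSelfAdjoint T) (hp : IsPositiveOp T) :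
    rpow T 1 = T := by
  apply LinearPMap.eq_of_eq_graph
  rw [graph_rpow hT hp one_pos]
  obtain ⟨h1, h2⟩ := boundedInverse_spec (exists_isBoundedInverse hT hp)
  have hsa : IsSelfAdjoint (boundedInverse (addScalar T 1)) :=
    IsSelfAdjoint.of_nonneg (boundedInverse_nonneg hT hp)
  ext ⟨f, g⟩
  rw [mem_powGraph]
  set R := boundedInverse (addScalar T 1)
  have e1 : (cfc (fun x : ℝ => x ^ (1 : ℝ)) R : H →L[ℂ] H) = R := by
    simp only [Real.rpow_one]
    exact cfc_id' ℝ R hsa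
  have e2 : (cfc (fun x : ℝ => (1 - x) ^ (1 : ℝ)) R : H →L[ℂ] H) = 1 - R := by
    simp only [Real.rpow_one]
    rw [cfc_sub (fun _ : ℝ => (1 : ℝ)) (fun x : ℝ => x) R, cfc_const_one ℝ R, cfc_id' ℝ R hsa]
  rw [e1, e2, sub_apply, one_apply_eq_self,
    LinearPMap.mem_graph_iff]
  constructor
  · intro h
    have hfe : R (f + g) = f := by rw [map_add, h]; abel
    obtain ⟨hf, ef⟩ := h1 (f + g)
    refine ⟨⟨R (f + g), hf⟩, hfe, ?_⟩
    replace ef : (1 : ℂ) • R (f + g) + T ⟨R (f + g), hf⟩ = f + g := ef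
    rw [one_smul] at ef
    exact add_left_cancel (ef.trans (congrArg (· + g) hfe.symm))
  · rintro ⟨u, rfl, rfl⟩
    have := h2 u
    rw [addScalar_apply, one_smul, map_add] at this
    exact eq_sub_of_add_eq' this

end UnboundedOp

open UnboundedOp

/-!
Let `R = (T + 1)⁻¹`, which is compact because `T` has compact resolvent, and let `s = ε / 2`.
If `g = T ^ s f`, then `R ^ s g = (1 - R) ^ s f` by definition of the power, so that
`f = R ^ s g + (1 - (1 - R) ^ s) f`. The functions `x ^ s` and `1 - (1 - x) ^ s` are continuous and
vanish at `0`, hence both operators on the right are compact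
(`isCompactOperator_cfc_of_map_zero`). The identity therefore puts every set on which `‖f‖` and
`‖T ^ s f‖` are bounded into a compact set (`exists_isCompact_of_rpow_bound`). By the assumed
estimate, this applies to the `f ∈ C` whose graph norm for `K` is at most a given constant, and
since `C` is a core, the bounded sets of `D(K)` in graph norm lie in compact sets too. A resolvent
of `K` maps the unit ball to such a set, so it is compact
(`isCompactOperator_of_graph_norm_ball`).
-/

namespace UnboundedOp

open scoped Pointwise

variable {H : Type*} [NormedAddCommGroup H] [InnerProductSpace ℂ H]

/-! ### Functional calculus of compact operators -/

/-- The bounded operators that are compact together with their adjoint, as a star subalgebra.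
Requiring both makes the set closed under adjoints without an appeal to Schauder's theorem. -/
def compactStarSubalgebra (H : Type*) [NormedAddCommGroup H] [InnerProductSpace ℂ H]
    [CompleteSpace H] : NonUnitalStarSubalgebra ℂ (H →L[ℂ] H) where
  carrier := {A | IsCompactOperator A ∧ IsCompactOperator (star A : H →L[ℂ] H)}
  add_mem' := fun {A B} hA hB => by
    refine ⟨hA.1.add hB.1, ?_⟩
    rw [star_add]
    exact hA.2.add hB.2
  zero_mem' := by
    refine ⟨isCompactOperator_zero, ?_⟩
    rw [star_zero]
    exact isCompactOperator_zero
  mul_mem' := fun {A B} hA hB => by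
    refine ⟨hA.1.comp_clm B, ?_⟩
    rw [star_mul]
    exact hB.2.comp_clm (star A)
  smul_mem' := fun z A hA => by
    refine ⟨hA.1.smul z, ?_⟩
    rw [star_smul]
    exact hA.2.smul (star z)
  star_mem' := fun {A} hA => ⟨hA.2, by rw [star_star]; exact hA.1⟩

theorem isClosed_compactStarSubalgebra [CompleteSpace H] :
    IsClosed (compactStarSubalgebra H : Set (H →L[ℂ] H)) := by
  have h : IsClosed {A : H →L[ℂ] H | IsCompactOperator A} := isClosed_setOfPred_isCompactOperator
  exact h.inter (h.preimage continuous_star)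

/-- A continuous function vanishing at `0` takes a compact self-adjoint operator to a compact
operator. -/
theorem isCompactOperator_cfc_of_map_zero [CompleteSpace H] {R : H →L[ℂ] H}
    (hR : IsCompactOperator R) (hsa : IsSelfAdjoint R) {φ : ℝ → ℝ} (hφ : Continuous φ)
    (h0 : φ 0 = 0) : IsCompactOperator (cfc φ R : H →L[ℂ] H) := by
  have hmem : R ∈ compactStarSubalgebra H := ⟨hR, by rwa [hsa.star_eq]⟩
  have := isClosed_compactStarSubalgebra (H := H)
  rw [← cfcₙ_eq_cfc hφ.continuousOn h0]
  exact (cfcₙ_mem (s := compactStarSubalgebra H) φ hmem).1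

/-! ### Powers of operators with compact resolvent -/

theorem HasCompactResolvent.isCompactOperator_boundedInverse {T : H →ₗ.[ℂ] H}
    (hT : HasCompactResolvent T)
    (h : ∃ S : H →L[ℂ] H, IsBoundedInverse (addScalar T 1) S) :
    IsCompactOperator (boundedInverse (addScalar T 1)) :=
  hT.2 (-1) _ (by rw [neg_neg]; exact boundedInverse_spec h)

/-- The embedding of `D(T ^ s)`, with the graph norm, into `H` is compact. -/
theorem exists_isCompact_of_rpow_bound [CompleteSpace H] {T : H →ₗ.[ℂ] H}
    (hT : IsSelfAdjoint T) (hp : IsPositiveOp T) (hc : HasCompactResolvent T) {s : ℝ} (hs : 0 < s)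
    (M : ℝ) :
    ∃ Q : Set H, IsCompact Q ∧
      ∀ f : (rpow T s).domain, ‖(f : H)‖ ≤ M → ‖rpow T s f‖ ≤ M → (f : H) ∈ Q := by
  have hcomp := hc.isCompactOperator_boundedInverse (exists_isBoundedInverse hT hp)
  have hsa : IsSelfAdjoint (boundedInverse (addScalar T 1)) :=
    IsSelfAdjoint.of_nonneg (boundedInverse_nonneg hT hp)
  have key : ∀ f : (rpow T s).domain, _ := fun f =>
    mem_powGraph.1 ((graph_rpow hT hp hs) ▸ (rpow T s).mem_graph f)
  set R := boundedInverse (addScalar T 1)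
  have hcont : Continuous fun x : ℝ => (1 - x) ^ s :=
    (Real.continuous_rpow_const hs.le).comp (continuous_const.sub continuous_id)
  have hA : IsCompactOperator (cfc (fun x : ℝ => x ^ s) R : H →L[ℂ] H) :=
    isCompactOperator_cfc_of_map_zero hcomp hsa (Real.continuous_rpow_const hs.le)
      (Real.zero_rpow hs.ne')
  have hZ : IsCompactOperator (cfc (fun x : ℝ => 1 - (1 - x) ^ s) R : H →L[ℂ] H) :=
    isCompactOperator_cfc_of_map_zero hcomp hsa (continuous_const.sub hcont) (by simp)
  have hZeq : (cfc (fun x : ℝ => 1 - (1 - x) ^ s) R : H →L[ℂ] H)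
      = 1 - cfc (fun x : ℝ => (1 - x) ^ s) R := by
    rw [cfc_sub (fun _ : ℝ => (1 : ℝ)) (fun x : ℝ => (1 - x) ^ s) R continuousOn_const
      hcont.continuousOn, cfc_const_one ℝ R]
  obtain ⟨Q₁, hQ₁, hAQ⟩ := hA.image_closedBall_subset_compact
    (f := (cfc (fun x : ℝ => x ^ s) R : H →L[ℂ] H).toLinearMap) M
  obtain ⟨Q₂, hQ₂, hZQ⟩ := hZ.image_closedBall_subset_compact
    (f := (cfc (fun x : ℝ => 1 - (1 - x) ^ s) R : H →L[ℂ] H).toLinearMap) M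
  refine ⟨Q₁ + Q₂, hQ₁.add hQ₂, fun f hf hg => ?_⟩
  refine Set.mem_add.2 ⟨_, hAQ ⟨rpow T s f, mem_closedBall_zero_iff.2 hg, rfl⟩,
    _, hZQ ⟨f, mem_closedBall_zero_iff.2 hf, rfl⟩, ?_⟩
  change (cfc (fun x : ℝ => x ^ s) R : H →L[ℂ] H) (rpow T s f)
    + (cfc (fun x : ℝ => 1 - (1 - x) ^ s) R : H →L[ℂ] H) f = f
  rw [key f, hZeq, sub_apply, one_apply_eq_self]
  abel

/-! ### Resolvents -/

/-- If the elements of a core with bounded graph norm lie in a compact set, then every resolvent is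
compact. -/
theorem isCompactOperator_of_graph_norm_ball {K : H →ₗ.[ℂ] H} {C : Set H} (hcore : IsCore K C)
    (h : ∀ M : ℝ, ∃ Q : Set H, IsCompact Q ∧
      ∀ p ∈ K.graph, p.1 ∈ C → ‖p.2‖ + ‖p.1‖ ≤ M → p.1 ∈ Q)
    {z : ℂ} {S : H →L[ℂ] H} (hS : IsBoundedInverse (addScalar K (-z)) S) :
    IsCompactOperator S := by
  obtain ⟨Q, hQ, hQmem⟩ := h (1 + ‖z‖ * ‖S‖ + ‖S‖ + 1)
  refine (isCompactOperator_iff_image_ball_subset_compact (𝕜₁ := ℂ) S.toLinearMap one_pos).2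
    ⟨Q, hQ, ?_⟩
  rintro _ ⟨g, hg, rfl⟩
  have hg1 : ‖g‖ ≤ 1 := (mem_ball_zero_iff.1 hg).le
  obtain ⟨hd, he⟩ := hS.1 g
  have hKS : K ⟨S g, hd⟩ = g + z • S g := by
    have he' : (-z) • S g + K ⟨S g, hd⟩ = g := he
    rw [neg_smul, neg_add_eq_iff_eq_add] at he'
    rw [he', add_comm]
  have hmem : (S g, g + z • S g) ∈ (K.graph : Set (H × H)) := by
    rw [← hKS]
    exact K.mem_graph ⟨S g, hd⟩
  rw [← hcore.closure_eq] at hmem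
  have hSg : ‖S g‖ ≤ ‖S‖ := S.unit_le_opNorm g hg1
  have hbound : ‖g + z • S g‖ + ‖S g‖ < 1 + ‖z‖ * ‖S‖ + ‖S‖ + 1 := by
    have h1 := norm_add_le g (z • S g)
    rw [norm_smul] at h1
    have h2 := mul_le_mul_of_nonneg_left hSg (norm_nonneg z)
    linarith
  -- Pairs near `(S g, K S g)` still satisfy the strict bound on the graph norm.
  have hopen : {p : H × H | ‖p.2‖ + ‖p.1‖ < 1 + ‖z‖ * ‖S‖ + ‖S‖ + 1}
      ∈ nhds (S g, g + z • S g) :=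
    (isOpen_lt (by fun_prop) continuous_const).mem_nhds hbound
  change S g ∈ Q
  rw [← hQ.isClosed.closure_eq]
  refine mem_closure_iff_nhds.2 fun U hU => ?_
  obtain ⟨p, ⟨hpU, hpM⟩, hpK, hpC⟩ := mem_closure_iff_nhds.1 hmem _
    (Filter.inter_mem (continuous_fst.continuousAt.preimage_mem_nhds hU) hopen)
  exact ⟨p.1, hpU, hQmem p hpK hpC (le_of_lt hpM)⟩

theorem IsQuasiMAccretive.resolventSet_nonempty {A : H →ₗ.[ℂ] H} (hA : IsQuasiMAccretive A) :
    (resolventSet A).Nonempty := by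
  obtain ⟨r, -, hr⟩ := hA
  obtain ⟨S, hS, -⟩ := hr 1 one_pos
  have hval : ∀ u : A.domain, addScalar A (-(-(r + 1) : ℂ)) u
      = addScalar (addScalar A (r : ℂ)) ((1 : ℝ) : ℂ) u := fun u => by
    change (-(-(r + 1) : ℂ)) • (u : H) + A u = ((1 : ℝ) : ℂ) • (u : H) + ((r : ℂ) • (u : H) + A u)
    rw [Complex.ofReal_one]
    module
  refine ⟨-(r + 1), S, fun f => ?_, fun u => ?_⟩
  · obtain ⟨hf, h⟩ := hS.1 f
    exact ⟨hf, (hval ⟨S f, hf⟩).trans h⟩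
  · exact (congrArg S (hval u)).trans (hS.2 u)

theorem neg_mem_resolventSet {A : H →ₗ.[ℂ] H} {z : ℂ} (hz : z ∈ resolventSet (-A)) :
    -z ∈ resolventSet A := by
  obtain ⟨S, hS⟩ := hz
  have hval : ∀ u : A.domain, addScalar A (-(-z)) u = -(addScalar (-A) (-z) u) := fun u => by
    change (-(-z)) • (u : H) + A u = -((-z) • (u : H) + -(A u))
    module
  refine ⟨-S, fun f => ?_, fun u => ?_⟩
  · obtain ⟨hf, h⟩ := hS.1 (-f)
    rw [map_neg] at hf
    refine ⟨hf, (hval ⟨-S f, hf⟩).trans ?_⟩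
    have h' : addScalar (-A) (-z) ⟨-S f, hf⟩ = -f := by
      rw [← h]
      congr 2
      exact (map_neg S f).symm
    exact (congrArg Neg.neg h').trans (neg_neg f)
  · change -(S (addScalar A (-(-z)) u)) = u
    rw [hval u, map_neg, neg_neg]
    exact hS.2 u

end UnboundedOp

open UnboundedOp
theorem mainTheorem7 {H : Type*} [NormedAddCommGroup H] [InnerProductSpace ℂ H] [CompleteSpace H]
    (C : Set H) (hC : Dense C)
    (K : H →ₗ.[ℂ] H) (hK : IsQuasiMAccretive K ∨ IsQuasiMDissipative K)
    (T : H →ₗ.[ℂ] H) (hT : IsSelfAdjoint T) (hTpos : IsPositiveOp T)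
    (hCT : C ⊆ (T.domain : Set H)) (hcore : IsCore K C) (hTcomp : HasCompactResolvent T)
    (c ε : ℝ) (hc : 0 < c) (hε : 0 < ε) (hε2 : ε < 2)
    (hest : ∀ (f : H) (hf : f ∈ C),
      ‖rpow T (ε / 2) ⟨f, domain_le_domain_rpow hT hTpos (half_pos hε)
        (by linarith) (hCT hf)⟩‖
        ≤ c * (‖K ⟨f, hcore.subset_domain hf⟩‖ + ‖f‖)) :
    HasCompactResolvent K := by
  refine ⟨?_, fun z S hS => isCompactOperator_of_graph_norm_ball hcore (fun M => ?_) hS⟩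
  · rcases hK with hK | hK
    · exact hK.resolventSet_nonempty
    · obtain ⟨z, hz⟩ := IsQuasiMAccretive.resolventSet_nonempty hK
      exact ⟨-z, neg_mem_resolventSet hz⟩
  · obtain ⟨Q, hQ, hmem⟩ := exists_isCompact_of_rpow_bound hT hTpos hTcomp (half_pos hε)
      (max M (c * M))
    refine ⟨Q, hQ, fun p hp hpC hpM => ?_⟩
    have hKp : K ⟨p.1, hcore.subset_domain hpC⟩ = p.2 := by
      obtain ⟨u, hu1, hu2⟩ := (LinearPMap.mem_graph_iff K).1 hp
      rw [← hu2]
      congr 1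
      exact Subtype.ext hu1.symm
    have hb := hest p.1 hpC
    rw [hKp] at hb
    refine hmem ⟨p.1, _⟩ (le_max_of_le_left ?_)
      (le_max_of_le_right (hb.trans (mul_le_mul_of_nonneg_left hpM hc.le)))
    exact (le_add_of_nonneg_left (norm_nonneg _)).trans hpM
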